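/- Let $G$ be a finite connected undirected graph without loops on a node set $\mathcal N$ with at least two nodes, in which every link $\{i,j\}$ carries a weight $c_{ij}=c_{ji}>0$; put $c_{ij}=0$ if $i$ and $j$ are not linked. Let $k_i=\sum_j c_{ij}$ be the (weighted) degrees and $m=\tfrac12\sum_i k_i$. Let $Q$ be the Laplacian matrix, $Q_{ii}=k_i$ and $Q_{ij}=-c_{ij}$ for $i\neq j$, let $Q^\dagger$ be its Moore–Penrose pseudoinverse, and let $\omega_{ij}=(e_i-e_j)^TQ^\dagger(e_i-e_j)$ be the effective resistance between $i$ and $j$, where $e_i$ are the unit vectors. The variance of a distribution $p$ on $\mathcal N$ with respect to the square-root effective resistance $\sqrt{\omega}$ is $$\operatorname{var}_\omega(p)=\frac12\sum_{i,j\in\mathcal N}p(i)\,p(j)\,\bigl(\sqrt{\omega_{ij}}\bigr)^2 .$$ Consider the random walk $(N_t)_{t\ge 0}$ on $G$, the Markov chain with $\Pr(N_{t+1}=j\mid N_t=i)=T_{ji}=c_{ij}/k_i$. Then the distribution $\pi(i)=k_i/(2m)$ is the unique stationary distribution of the walk, that is, the unique probability distribution $p$ on $\mathcal N$ with $Tp=p$.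 Moreover, for a node $i$ let $\kappa_i=\mathbb E\bigl[\min\{t\ge 0: N_t=J\}\bigr]$ be the expected time at which the walk started at $N_0=i$ first reaches a random node $J\sim\pi$ that is independent of the walk. Then $\kappa_i$ is finite, it does not depend on $i$, and its common value $\kappa$ (Kemeny's constant) satisfies $$\kappa = 2m\operatorname{var}_\omega(\pi).$$ -/

import Mathlib

open MeasureTheory ProbabilityTheory Matrix
open scoped ENNReal

/-- The four Penrose conditions: `X` is a Moore-Penrose pseudoinverse of the real matrix `A`. -/
structure IsMoorePenroseInverse {V : Type*} [Fintype V] (A X : Matrix V V ℝ) : Prop where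
  mul_mul_self : A * X * A = A
  self_mul_mul : X * A * X = X
  symm_left : (A * X)ᵀ = A * X
  symm_right : (X * A)ᵀ = X * A

/-- A Moore-Penrose pseudoinverse is unique. -/
theorem IsMoorePenroseInverse.unique {V : Type*} [Fintype V] {A X Y : Matrix V V ℝ}
    (hX : IsMoorePenroseInverse A X) (hY : IsMoorePenroseInverse A Y) : X = Y := by
  have h1 : A * X = A * Y := by
    calc A * X = (A * X)ᵀ := hX.symm_left.symm
      _ = ((A * Y) * (A * X))ᵀ := by rw [← Matrix.mul_assoc (A * Y) A X, hY.mul_mul_self]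
      _ = (A * X) * (A * Y) := by rw [Matrix.transpose_mul, hX.symm_left, hY.symm_left]
      _ = A * Y := by rw [← Matrix.mul_assoc (A * X) A Y, hX.mul_mul_self]
  have h2 : X * A = Y * A := by
    calc X * A = (X * A)ᵀ := hX.symm_right.symm
      _ = ((X * A) * (Y * A))ᵀ := by
          rw [Matrix.mul_assoc X A (Y * A), ← Matrix.mul_assoc A Y A, hY.mul_mul_self]
      _ = (Y * A) * (X * A) := by rw [Matrix.transpose_mul, hX.symm_right, hY.symm_right]
      _ = Y * A := by rw [Matrix.mul_assoc Y A (X * A), ← Matrix.mul_assoc A X A, hX.mul_mul_self]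
  calc X = X * A * X := hX.self_mul_mul.symm
    _ = Y * A * X := by rw [h2]
    _ = Y * A * Y := by rw [Matrix.mul_assoc, h1, ← Matrix.mul_assoc]
    _ = Y := hY.self_mul_mul

/-- A real symmetric matrix has a Moore-Penrose pseudoinverse. -/
theorem exists_isMoorePenroseInverse {V : Type*} [Fintype V] [DecidableEq V]
    {A : Matrix V V ℝ} (hA : A.IsSymm) : ∃ X, IsMoorePenroseInverse A X := by
  have hH : A.IsHermitian := by
    rw [Matrix.IsHermitian, Matrix.conjTranspose_eq_transpose_of_trivial]; exact hA
  obtain ⟨U, d, hU, hAd⟩ : ∃ (U : Matrix V V ℝ) (d : V → ℝ),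
      Uᵀ * U = 1 ∧ A = U * diagonal d * Uᵀ := by
    refine ⟨hH.eigenvectorUnitary, hH.eigenvalues, ?_, ?_⟩
    · have h := Unitary.coe_star_mul_self hH.eigenvectorUnitary
      rwa [Matrix.star_eq_conjTranspose, Matrix.conjTranspose_eq_transpose_of_trivial] at h
    · have h := hH.spectral_theorem
      rw [Unitary.conjStarAlgAut_apply, Matrix.star_eq_conjTranspose,
        Matrix.conjTranspose_eq_transpose_of_trivial] at h
      exact h
  have key : ∀ a b : V → ℝ, (U * diagonal a * Uᵀ) * (U * diagonal b * Uᵀ)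
      = U * diagonal (fun i => a i * b i) * Uᵀ := by
    intro a b
    calc (U * diagonal a * Uᵀ) * (U * diagonal b * Uᵀ)
        = U * diagonal a * (Uᵀ * U) * diagonal b * Uᵀ := by simp only [Matrix.mul_assoc]
      _ = U * (diagonal a * diagonal b) * Uᵀ := by
          rw [hU, Matrix.mul_one, Matrix.mul_assoc U]
      _ = _ := by rw [Matrix.diagonal_mul_diagonal]
  have keyT : ∀ a : V → ℝ, (U * diagonal a * Uᵀ)ᵀ = U * diagonal a * Uᵀ := by
    intro a
    simp only [Matrix.transpose_mul, Matrix.transpose_transpose, Matrix.diagonal_transpose,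
      Matrix.mul_assoc]
  subst hAd
  refine ⟨U * diagonal (fun i => (d i)⁻¹) * Uᵀ, ⟨?_, ?_, ?_, ?_⟩⟩
  · rw [key, key]; congr; funext i; exact mul_inv_mul_cancel (d i)
  · rw [key, key]; congr; funext i
    by_cases h : d i = 0
    · simp [h]
    · field_simp
  · rw [key, keyT]
  · rw [key, keyT]

open scoped Classical in
/-- The Moore-Penrose pseudoinverse `A†` of a real square matrix. -/
noncomputable def moorePenroseInverse {V : Type*} [Fintype V] (A : Matrix V V ℝ) :
    Matrix V V ℝ :=
  if h : ∃ X, IsMoorePenroseInverse A X then h.choose else 0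

/-- For symmetric matrices the pseudoinverse satisfies the Penrose conditions. -/
theorem moorePenroseInverse_spec {V : Type*} [Fintype V] [DecidableEq V]
    {A : Matrix V V ℝ} (hA : A.IsSymm) : IsMoorePenroseInverse A (moorePenroseInverse A) := by
  have h := exists_isMoorePenroseInverse hA
  rw [moorePenroseInverse, dif_pos h]
  exact h.choose_spec

/-- The variance `½ ∑ i j, p i * p j * d(i, j)²` of a distribution `p` with respect to a
distance function `d`. -/
noncomputable def graphVariance {V : Type*} [Fintype V] (d : V → V → ℝ) (p : V → ℝ) : ℝ :=
  (1 / 2) * ∑ i, ∑ j, p i * p j * d i j ^ 2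

/-- The first time `t ≥ 0` at which the trajectory `x` is at the node `j` (`⊤` if there is none). -/
noncomputable def hittingTime {V : Type*} (x : ℕ → V) (j : V) : ℕ∞ :=
  hittingAfter (fun (t : ℕ) (y : ℕ → V) => y t) {j} 0 x

/-- A connected (undirected) graph with a positive weight on every link. -/
structure WeightedGraph (V : Type*) where
  /-- the links of the graph -/
  links : SimpleGraph V
  connected : links.Connected
  /-- the weights `c i j`, extended by zero to pairs of nodes that are not linked -/
  weight : V → V → ℝ
  weight_symm : ∀ i j, weight i j = weight j i
  weight_pos : ∀ i j, links.Adj i j → 0 < weight i j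
  weight_eq_zero : ∀ i j, ¬ links.Adj i j → weight i j = 0

namespace WeightedGraph

theorem weight_nonneg {V : Type*} (G : WeightedGraph V) (i j : V) : 0 ≤ G.weight i j := by
  by_cases h : G.links.Adj i j
  · exact (G.weight_pos i j h).le
  · exact (G.weight_eq_zero i j h).ge

variable {V : Type*} [Fintype V]

/-- The weighted degree `k i = ∑ j, c i j`. -/
noncomputable def degree (G : WeightedGraph V) (i : V) : ℝ := ∑ j, G.weight i j

/-- The total weight `m = ½ ∑ i, k i` of the links. -/
noncomputable def totalWeight (G : WeightedGraph V) : ℝ := (1 / 2) * ∑ i, G.degree i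

/-- The Laplacian matrix `Q`. -/
noncomputable def laplacian [DecidableEq V] (G : WeightedGraph V) : Matrix V V ℝ :=
  Matrix.of fun i j => if i = j then G.degree i else - G.weight i j

/-- The effective resistance `ω i j = (e_i - e_j)ᵀ Q† (e_i - e_j)`. -/
noncomputable def effectiveResistance [DecidableEq V] (G : WeightedGraph V) (i j : V) : ℝ :=
  (Pi.single i 1 - Pi.single j 1) ⬝ᵥ
    (moorePenroseInverse G.laplacian *ᵥ (Pi.single i 1 - Pi.single j 1))

/-- The variance with respect to the square root effective resistance. -/
noncomputable def resistanceVariance [DecidableEq V] (G : WeightedGraph V) (p : V → ℝ) : ℝ :=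
  graphVariance (fun i j => Real.sqrt (G.effectiveResistance i j)) p

/-- The transition matrix of the random walk, `T j i = c i j / k i`, the probability of a step
from `i` to `j`. -/
noncomputable def transitionMatrix (G : WeightedGraph V) : Matrix V V ℝ :=
  Matrix.of fun j i => G.weight i j / G.degree i

/-- A probability distribution `p` with `T p = p`. -/
def IsStationary (G : WeightedGraph V) (p : V → ℝ) : Prop :=
  p ∈ stdSimplex ℝ V ∧ G.transitionMatrix *ᵥ p = p

/-- The distribution `π i = k i / (2 m)`. -/
noncomputable def stationary (G : WeightedGraph V) (i : V) : ℝ :=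
  G.degree i / (2 * G.totalWeight)

theorem degree_pos [Nontrivial V] (G : WeightedGraph V) (i : V) : 0 < G.degree i := by
  obtain ⟨j, hj⟩ := G.connected.preconnected.exists_adj_of_nontrivial i
  exact Finset.sum_pos' (fun j _ => G.weight_nonneg i j)
    ⟨j, Finset.mem_univ j, G.weight_pos i j hj⟩

variable [MeasurableSpace V] [DiscreteMeasurableSpace V]

/-- The Markov kernel of one step of the random walk: from `i` move to `j` with probability
`T j i`. -/
noncomputable def stepKernel (G : WeightedGraph V) : Kernel V V where
  toFun i := ∑ j, ENNReal.ofReal (G.transitionMatrix j i) • Measure.dirac j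
  measurable' := Measurable.of_discrete

instance [Nontrivial V] (G : WeightedGraph V) : IsMarkovKernel G.stepKernel where
  isProbabilityMeasure i := by
    constructor
    change (∑ j, ENNReal.ofReal (G.transitionMatrix j i) • Measure.dirac j : Measure V)
      Set.univ = 1
    have h0 := (G.degree_pos i).ne'
    simp only [Measure.coe_finsetSum, Measure.coe_smul, Finset.sum_apply, Pi.smul_apply,
      measure_univ, smul_eq_mul, mul_one, transitionMatrix, Matrix.of_apply]
    rw [← ENNReal.ofReal_sum_of_nonneg
      fun j _ => div_nonneg (G.weight_nonneg i j) (G.degree_pos i).le, ← Finset.sum_div]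
    simp only [degree] at h0 ⊢
    rw [div_self h0, ENNReal.ofReal_one]

/-- The law, on the space of trajectories `ℕ → V`, of the random walk started at the node `i`:
the first node is `i`, and given the trajectory up to time `n` the node at time `n + 1` is
distributed according to the step kernel at the node at time `n`. -/
noncomputable def walkLaw [Nontrivial V] (G : WeightedGraph V) (i : V) : Measure (ℕ → V) :=
  Kernel.trajMeasure (X := fun _ => V) (Measure.dirac i) fun n =>
    G.stepKernel.comap (fun h : (Finset.Iic n → V) => h ⟨n, Finset.mem_Iic.2 le_rfl⟩)
      (measurable_pi_apply _)

/-- The law of a random node `J ∼ π`. -/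
noncomputable def stationaryLaw (G : WeightedGraph V) : Measure V :=
  ∑ j, ENNReal.ofReal (G.stationary j) • Measure.dirac j

/-- The expected time `κ_i` which the random walk started at `i` takes to reach a random node `J`
that is independent of the walk and has law `π`. -/
noncomputable def kemenyTime [Nontrivial V] (G : WeightedGraph V) (i : V) : ℝ≥0∞ :=
  ∫⁻ z : (ℕ → V) × V, (hittingTime z.1 z.2 : ℝ≥0∞) ∂((G.walkLaw i).prod G.stationaryLaw)

end WeightedGraph

/-! Let `X` be the pseudoinverse of the Laplacian. For a target `j`, first-step analysis says that
the mean hitting time `g` satisfies `g j = 0` and `Q g = k - 2m e_j` away from `j`. The coefficient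
`2m` gives the right side zero sum. By connectedness the kernel of `Q` is the constants, so `X`
solves this equation, and subtracting the value at `j` yields `meanHittingTime`: `g i = 2m ((Xπ) i -
X i j - (Xπ) j + X j j)`. Averaging over `j ∼ π` cancels the two terms containing `i`. What remains,
`∑ π j X j j - π·Xπ`, is the resistance variance, because `ω i j = X i i + X j j - 2 X i j`.

That `g` really is the expected hitting time follows by telescoping
(`lintegral_hittingTime_walkLaw`): the integral of `g (x t)` over the trajectories that have avoided
`j` up to time `t` drops at each step by the probability of that event. Finiteness comes out of the
same argument. Uniqueness of `π` is again the statement about the kernel, applied to `p / k`. -/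

/-! ### Symmetry of the pseudoinverse -/

theorem IsMoorePenroseInverse.transpose {V : Type*} [Fintype V] {A X : Matrix V V ℝ}
    (h : IsMoorePenroseInverse A X) : IsMoorePenroseInverse Aᵀ Xᵀ where
  mul_mul_self := by
    simpa only [Matrix.transpose_mul, Matrix.mul_assoc] using
      congrArg Matrix.transpose h.mul_mul_self
  self_mul_mul := by
    simpa only [Matrix.transpose_mul, Matrix.mul_assoc] using
      congrArg Matrix.transpose h.self_mul_mul
  symm_left := by rw [← Matrix.transpose_mul, h.symm_right, h.symm_right]
  symm_right := by rw [← Matrix.transpose_mul, h.symm_left, h.symm_left]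

theorem moorePenroseInverse_isSymm {V : Type*} [Fintype V] [DecidableEq V]
    {A : Matrix V V ℝ} (hA : A.IsSymm) : (moorePenroseInverse A).IsSymm := by
  have h := moorePenroseInverse_spec hA
  have h' := h.transpose
  rw [hA.eq] at h'
  exact h'.unique h

/-! ### The Laplacian: quadratic form, kernel and range -/

namespace WeightedGraph

theorem weight_self {V : Type*} (G : WeightedGraph V) (i : V) : G.weight i i = 0 :=
  G.weight_eq_zero i i G.links.irrefl

variable {V : Type*} [Fintype V]

theorem sum_degree (G : WeightedGraph V) : ∑ i, G.degree i = 2 * G.totalWeight := by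
  rw [totalWeight]; ring

theorem totalWeight_pos [Nontrivial V] (G : WeightedGraph V) : 0 < G.totalWeight :=
  mul_pos (by norm_num) (Finset.sum_pos (fun i _ => G.degree_pos i) Finset.univ_nonempty)

theorem sum_stationary [Nontrivial V] (G : WeightedGraph V) : ∑ i, G.stationary i = 1 := by
  have h := G.totalWeight_pos
  simp only [stationary, ← Finset.sum_div, sum_degree]
  exact div_self (by positivity)

theorem stationary_nonneg [Nontrivial V] (G : WeightedGraph V) (i : V) : 0 ≤ G.stationary i :=
  div_nonneg (G.degree_pos i).le (by linarith [G.totalWeight_pos])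

theorem two_mul_totalWeight_mul_stationary [Nontrivial V] (G : WeightedGraph V) (i : V) :
    2 * G.totalWeight * G.stationary i = G.degree i := by
  have h := G.totalWeight_pos
  rw [stationary]; field_simp

theorem sum_transitionMatrix [Nontrivial V] (G : WeightedGraph V) (i : V) :
    ∑ j, G.transitionMatrix j i = 1 := by
  simp only [transitionMatrix, Matrix.of_apply, ← Finset.sum_div]
  exact div_self (G.degree_pos i).ne'

variable [DecidableEq V]

theorem laplacian_eq (G : WeightedGraph V) :
    G.laplacian = diagonal G.degree - Matrix.of G.weight := by
  ext i j
  by_cases h : i = j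
  · subst h; simp [laplacian, weight_self]
  · simp [laplacian, h]

theorem laplacian_isSymm (G : WeightedGraph V) : G.laplacian.IsSymm := by
  rw [laplacian_eq, Matrix.IsSymm, Matrix.transpose_sub, Matrix.diagonal_transpose]
  congr 1
  ext i j
  exact G.weight_symm j i

theorem laplacian_mulVec (G : WeightedGraph V) (f : V → ℝ) (i : V) :
    (G.laplacian *ᵥ f) i = G.degree i * f i - ∑ j, G.weight i j * f j := by
  rw [laplacian_eq, Matrix.sub_mulVec, Pi.sub_apply, Matrix.mulVec_diagonal]
  rfl

theorem dotProduct_laplacian_mulVec (G : WeightedGraph V) (f : V → ℝ) :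
    f ⬝ᵥ (G.laplacian *ᵥ f) = (1 / 2) * ∑ i, ∑ j, G.weight i j * (f i - f j) ^ 2 := by
  have h1 : ∑ i, ∑ j, G.weight i j * (f j) ^ 2 = ∑ i, G.degree i * f i ^ 2 := by
    rw [Finset.sum_comm]
    simp only [degree, Finset.sum_mul]
    simp_rw [G.weight_symm]
  have h2 : ∑ i, ∑ j, G.weight i j * (f i) ^ 2 = ∑ i, G.degree i * f i ^ 2 := by
    simp only [degree, Finset.sum_mul]
  have h3 : f ⬝ᵥ (G.laplacian *ᵥ f)
      = ∑ i, G.degree i * f i ^ 2 - ∑ i, ∑ j, G.weight i j * (f i * f j) := by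
    simp only [dotProduct, laplacian_mulVec, mul_sub, Finset.sum_sub_distrib, Finset.mul_sum]
    congr 1
    · exact Finset.sum_congr rfl fun i _ => by ring
    · exact Finset.sum_congr rfl fun i _ => Finset.sum_congr rfl fun j _ => by ring
  have h4 : ∑ i, ∑ j, G.weight i j * (f i - f j) ^ 2
      = ∑ i, ∑ j, G.weight i j * (f i) ^ 2 + ∑ i, ∑ j, G.weight i j * (f j) ^ 2
        - 2 * ∑ i, ∑ j, G.weight i j * (f i * f j) := by
    simp only [Finset.mul_sum, ← Finset.sum_add_distrib, ← Finset.sum_sub_distrib]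
    exact Finset.sum_congr rfl fun i _ => Finset.sum_congr rfl fun j _ => by ring
  rw [h3, h4, h1, h2]; ring

theorem dotProduct_laplacian_mulVec_nonneg (G : WeightedGraph V) (f : V → ℝ) :
    0 ≤ f ⬝ᵥ (G.laplacian *ᵥ f) := by
  rw [dotProduct_laplacian_mulVec]
  exact mul_nonneg (by norm_num) (Finset.sum_nonneg fun i _ => Finset.sum_nonneg fun j _ =>
    mul_nonneg (G.weight_nonneg i j) (sq_nonneg _))

/-- The quadratic form vanishes at `f`, hence so does each of its nonnegative terms. So `f` agrees
at the ends of every link, and then along every walk. -/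
theorem eq_of_laplacian_mulVec_eq_zero (G : WeightedGraph V) {f : V → ℝ}
    (hf : G.laplacian *ᵥ f = 0) (i j : V) : f i = f j := by
  have h0 := G.dotProduct_laplacian_mulVec f
  rw [hf, dotProduct_zero] at h0
  have hnn : ∀ i j, 0 ≤ G.weight i j * (f i - f j) ^ 2 := fun i j =>
    mul_nonneg (G.weight_nonneg i j) (sq_nonneg _)
  have h1 : ∑ i, ∑ j, G.weight i j * (f i - f j) ^ 2 = 0 := by linarith
  have hadj : ∀ i j, G.links.Adj i j → f i = f j := by
    intro i j hij
    rw [Finset.sum_eq_zero_iff_of_nonneg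
      fun i _ => Finset.sum_nonneg fun j _ => hnn i j] at h1
    have h2 := h1 i (Finset.mem_univ i)
    rw [Finset.sum_eq_zero_iff_of_nonneg fun j _ => hnn i j] at h2
    have h3 := h2 j (Finset.mem_univ j)
    have h4 := (mul_eq_zero.1 h3).resolve_left (G.weight_pos i j hij).ne'
    exact sub_eq_zero.1 (pow_eq_zero_iff two_ne_zero |>.1 h4)
  obtain ⟨w⟩ := G.connected.preconnected i j
  induction w with
  | nil => rfl
  | cons h _ ih => exact (hadj _ _ h).trans ih

/-- On vectors of zero sum the pseudoinverse of the Laplacian is a right inverse. -/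
theorem laplacian_mulVec_moorePenroseInverse_mulVec [Nonempty V] (G : WeightedGraph V) {w : V → ℝ}
    (hw : ∑ i, w i = 0) : G.laplacian *ᵥ (moorePenroseInverse G.laplacian *ᵥ w) = w := by
  have h := moorePenroseInverse_spec G.laplacian_isSymm
  have hs := G.laplacian_isSymm
  set A := G.laplacian
  set X := moorePenroseInverse A
  have h1 : A * (A * X) = A := by
    have := congrArg transpose h.mul_mul_self
    rwa [Matrix.transpose_mul, h.symm_left, hs.eq] at this
  -- The residual lies in the kernel of the Laplacian, so it is constant. It also has zero sum,
  -- since all column sums of the Laplacian vanish; hence it is zero.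
  have hconst : ∀ i j, (w - A *ᵥ (X *ᵥ w)) i = (w - A *ᵥ (X *ᵥ w)) j := by
    refine G.eq_of_laplacian_mulVec_eq_zero ?_
    change A *ᵥ _ = 0
    rw [Matrix.mulVec_sub, Matrix.mulVec_mulVec, Matrix.mulVec_mulVec, Matrix.mul_assoc, h1,
      sub_self]
  have hcol : ∀ f : V → ℝ, ∑ i, (A *ᵥ f) i = 0 := by
    intro f
    simp only [A, laplacian_mulVec, Finset.sum_sub_distrib]
    rw [Finset.sum_comm]
    simp only [degree, ← Finset.sum_mul]
    simp_rw [G.weight_symm, sub_self]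
  have hsum : ∑ i, (w - A *ᵥ (X *ᵥ w)) i = 0 := by
    simp only [Pi.sub_apply, Finset.sum_sub_distrib, hw, hcol, sub_self]
  ext i
  rw [Finset.sum_congr rfl fun j _ => hconst j i, Finset.sum_const, nsmul_eq_mul] at hsum
  have hcard : ((Finset.univ : Finset V).card : ℝ) ≠ 0 := by
    simp
  exact (sub_eq_zero.1 ((mul_eq_zero.1 hsum).resolve_left hcard)).symm

/-! ### Effective resistance and mean hitting times through the pseudoinverse -/

/-- Since `X = X A X` with `X` symmetric, `u·Xu` is the Laplacian form at `Xu`. Nonnegativity is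
what lets the square in the variance undo the square root. -/
theorem effectiveResistance_nonneg (G : WeightedGraph V) (i j : V) :
    0 ≤ G.effectiveResistance i j := by
  have h := moorePenroseInverse_spec G.laplacian_isSymm
  have hX := moorePenroseInverse_isSymm G.laplacian_isSymm
  rw [effectiveResistance]
  set u : V → ℝ := Pi.single i 1 - Pi.single j 1
  rw [← h.self_mul_mul, ← Matrix.mulVec_mulVec, ← Matrix.mulVec_mulVec, Matrix.dotProduct_mulVec,
    ← Matrix.mulVec_transpose, hX.eq]
  exact G.dotProduct_laplacian_mulVec_nonneg _

theorem effectiveResistance_eq (G : WeightedGraph V) (i j : V) :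
    G.effectiveResistance i j = moorePenroseInverse G.laplacian i i
      + moorePenroseInverse G.laplacian j j - 2 * moorePenroseInverse G.laplacian i j := by
  have hX := (moorePenroseInverse_isSymm G.laplacian_isSymm).apply i j
  rw [effectiveResistance]
  simp only [Matrix.mulVec_sub, Matrix.mulVec_single_one, sub_dotProduct, single_one_dotProduct,
    Pi.sub_apply, Matrix.col_apply]
  rw [hX]; ring

theorem resistanceVariance_eq (G : WeightedGraph V) {p : V → ℝ} (hp : ∑ i, p i = 1) :
    G.resistanceVariance p = ∑ i, p i * moorePenroseInverse G.laplacian i i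
      - ∑ i, p i * (moorePenroseInverse G.laplacian *ᵥ p) i := by
  have h0 : ∀ i, (moorePenroseInverse G.laplacian *ᵥ p) i
      = ∑ j, moorePenroseInverse G.laplacian i j * p j := fun i => rfl
  simp only [resistanceVariance, graphVariance, Real.sq_sqrt (G.effectiveResistance_nonneg _ _),
    h0]
  simp only [effectiveResistance_eq]
  set X := moorePenroseInverse G.laplacian
  have h1 : ∑ i, ∑ j, p i * p j * X i i = ∑ i, p i * X i i := by
    refine Finset.sum_congr rfl fun i _ => ?_
    rw [← Finset.sum_mul, ← Finset.mul_sum, hp, mul_one]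
  have h2 : ∑ i, ∑ j, p i * p j * X j j = ∑ i, p i * X i i := by
    rw [Finset.sum_comm, ← h1]
    exact Finset.sum_congr rfl fun i _ => Finset.sum_congr rfl fun j _ => by ring
  have h3 : ∑ i, ∑ j, p i * p j * (2 * X i j) = 2 * ∑ i, p i * ∑ j, X i j * p j := by
    simp only [Finset.mul_sum]
    exact Finset.sum_congr rfl fun i _ => Finset.sum_congr rfl fun j _ => by ring
  simp only [mul_sub, mul_add, Finset.sum_sub_distrib, Finset.sum_add_distrib, h1, h2, h3]
  ring

/-- The solution `g` of `g j = 0` and `g x = 1 + ∑ y, T y x * g y` for `x ≠ j`, expressed through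
the pseudoinverse of the Laplacian. -/
noncomputable def meanHittingTime (G : WeightedGraph V) (j i : V) : ℝ :=
  (moorePenroseInverse G.laplacian *ᵥ
    (G.degree - Pi.single j (2 * G.totalWeight) : V → ℝ)) i
    - (moorePenroseInverse G.laplacian *ᵥ
    (G.degree - Pi.single j (2 * G.totalWeight) : V → ℝ)) j

theorem meanHittingTime_self (G : WeightedGraph V) (j : V) : G.meanHittingTime j j = 0 :=
  sub_self _

theorem sum_transitionMatrix_mul_meanHittingTime [Nontrivial V] (G : WeightedGraph V) {i j : V}
    (hij : i ≠ j) :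
    ∑ y, G.transitionMatrix y i * G.meanHittingTime j y = G.meanHittingTime j i - 1 := by
  have hk := (G.degree_pos i).ne'
  have hw : ∑ x, (G.degree - Pi.single j (2 * G.totalWeight) : V → ℝ) x = 0 := by
    simp [Finset.sum_sub_distrib, sum_degree]
  have h := congrFun (G.laplacian_mulVec_moorePenroseInverse_mulVec hw) i
  -- Away from `j` the right side is just the degree of `i`; dividing by it turns the Laplacian
  -- equation into the first-step equation.
  rw [laplacian_mulVec, Pi.sub_apply, Pi.single_eq_of_ne hij, sub_zero] at h
  simp only [meanHittingTime, mul_sub, Finset.sum_sub_distrib, ← Finset.sum_mul,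
    sum_transitionMatrix]
  set f := moorePenroseInverse G.laplacian *ᵥ
    (G.degree - Pi.single j (2 * G.totalWeight) : V → ℝ)
  have h1 : ∑ y, G.transitionMatrix y i * f y = (∑ y, G.weight i y * f y) / G.degree i := by
    rw [Finset.sum_div]
    exact Finset.sum_congr rfl fun y _ => by rw [transitionMatrix, Matrix.of_apply]; ring
  have h2 : ∑ y, G.weight i y * f y = G.degree i * (f i - 1) := by linarith
  rw [h1, h2, mul_div_cancel_left₀ _ hk]
  ring

theorem sum_stationary_mul_meanHittingTime [Nontrivial V] (G : WeightedGraph V) (i : V) :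
    ∑ j, G.stationary j * G.meanHittingTime j i
      = 2 * G.totalWeight * G.resistanceVariance G.stationary := by
  have hX := moorePenroseInverse_isSymm G.laplacian_isSymm
  have hdeg : G.degree = (2 * G.totalWeight) • G.stationary := by
    ext x; exact (G.two_mul_totalWeight_mul_stationary x).symm
  rw [G.resistanceVariance_eq G.sum_stationary]
  simp only [meanHittingTime]
  set X := moorePenroseInverse G.laplacian
  have hf : ∀ j x, (X *ᵥ (G.degree - Pi.single j (2 * G.totalWeight) : V → ℝ)) x
      = 2 * G.totalWeight * ((X *ᵥ G.stationary) x - X x j) := by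
    intro j x
    rw [Matrix.mulVec_sub, hdeg, Matrix.mulVec_smul, Matrix.mulVec_single]
    simp
    ring
  have hi : ∑ j, G.stationary j * X i j = (X *ᵥ G.stationary) i :=
    Finset.sum_congr rfl fun j _ => mul_comm _ _
  simp only [hf]
  calc _ = 2 * G.totalWeight * ((∑ j, G.stationary j) * (X *ᵥ G.stationary) i
        - ∑ j, G.stationary j * X i j + (∑ j, G.stationary j * X j j
        - ∑ j, G.stationary j * (X *ᵥ G.stationary) j)) := by
        rw [Finset.sum_mul, ← Finset.sum_sub_distrib, ← Finset.sum_sub_distrib,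
          ← Finset.sum_add_distrib, Finset.mul_sum]
        exact Finset.sum_congr rfl fun j _ => by ring
    _ = _ := by rw [sum_stationary, hi]; ring

/-- Mean hitting times are nonnegative, by the maximum principle at a minimum of `g`. -/
theorem meanHittingTime_nonneg [Nontrivial V] (G : WeightedGraph V) (j i : V) :
    0 ≤ G.meanHittingTime j i := by
  obtain ⟨x, hx⟩ := Finite.exists_min (G.meanHittingTime j)
  by_cases h : x = j
  · rw [h, G.meanHittingTime_self] at hx
    exact hx i
  · have h1 := G.sum_transitionMatrix_mul_meanHittingTime h
    have h2 : ∑ y, G.transitionMatrix y x * G.meanHittingTime j x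
        ≤ ∑ y, G.transitionMatrix y x * G.meanHittingTime j y :=
      Finset.sum_le_sum fun y _ => mul_le_mul_of_nonneg_left (hx y)
        (div_nonneg (G.weight_nonneg x y) (G.degree_pos x).le)
    rw [← Finset.sum_mul, sum_transitionMatrix] at h2
    linarith

/-! ### The stationary distribution -/

theorem isStationary_iff [Nontrivial V] (G : WeightedGraph V) (p : V → ℝ) :
    G.IsStationary p ↔ p = G.stationary := by
  constructor
  · rintro ⟨⟨_, hp1⟩, hp⟩
    -- By symmetry of the weights, `T p = p` says that `p / k` is harmonic. It is therefore
    -- constant, and total mass one fixes the constant as `1 / (2m)`.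
    have hL : G.laplacian *ᵥ (fun i => p i / G.degree i) = 0 := by
      ext i
      rw [laplacian_mulVec, mul_div_cancel₀ _ (G.degree_pos i).ne', Pi.zero_apply, sub_eq_zero]
      conv_lhs => rw [← hp]
      refine Finset.sum_congr rfl fun j _ => ?_
      change G.weight j i / G.degree j * p j = _
      rw [G.weight_symm]
      ring
    ext i
    have hc : ∀ j, p j = p i / G.degree i * G.degree j := fun j => by
      rw [← G.eq_of_laplacian_mulVec_eq_zero hL j i, div_mul_cancel₀ _ (G.degree_pos j).ne']
    have hm := G.totalWeight_pos
    have h2 : p i / G.degree i * (2 * G.totalWeight) = 1 := by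
      rw [← sum_degree, Finset.mul_sum, ← hp1]
      exact Finset.sum_congr rfl fun j _ => (hc j).symm
    rw [hc i, stationary, eq_div_iff (by positivity), mul_right_comm, h2, one_mul]
  · rintro rfl
    refine ⟨⟨G.stationary_nonneg, G.sum_stationary⟩, ?_⟩
    ext j
    change ∑ i, G.transitionMatrix j i * G.stationary i = _
    have : ∀ i, G.transitionMatrix j i * G.stationary i
        = G.weight j i / (2 * G.totalWeight) := fun i => by
      have := (G.degree_pos i).ne'
      rw [transitionMatrix, Matrix.of_apply, stationary, G.weight_symm]
      field_simp
    simp only [this, ← Finset.sum_div]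
    rfl

end WeightedGraph

/-! ### Expected hitting times as sums of tail probabilities -/

theorem ENat.toENNReal_eq_tsum (N : ℕ∞) :
    (N : ℝ≥0∞) = ∑' t : ℕ, if (t : ℕ∞) < N then 1 else 0 := by
  induction N using ENat.recTopCoe with
  | top => simp
  | coe n =>
    rw [tsum_eq_sum (s := Finset.range n) fun t ht => if_neg (by simpa using ht)]
    simp [Finset.filter_true_of_mem]

theorem lt_hittingTime_iff {V : Type*} (x : ℕ → V) (j : V) (t : ℕ) :
    (t : ℕ∞) < hittingTime x j ↔ ∀ s ≤ t, x s ≠ j := by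
  rw [← not_le]
  refine (not_congr (hittingAfter_le_iff (u := fun (t : ℕ) (y : ℕ → V) => y t) (s := {j})
    (n := 0) (i := t) (ω := x))).trans ?_
  simp

/-- The trajectories that avoid the node `j` up to time `t`. -/
def avoiding {V : Type*} (j : V) (t : ℕ) : Set (ℕ → V) := {x | ∀ s ≤ t, x s ≠ j}

theorem hittingTime_eq_tsum {V : Type*} (x : ℕ → V) (j : V) :
    (hittingTime x j : ℝ≥0∞) = ∑' t : ℕ, (avoiding j t).indicator 1 x := by
  classical
  rw [ENat.toENNReal_eq_tsum]
  refine tsum_congr fun t => ?_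
  simp only [lt_hittingTime_iff, Set.indicator_apply, avoiding, Set.mem_ofPred_eq, Pi.one_apply]

theorem avoiding_succ {V : Type*} (j : V) (t : ℕ) :
    avoiding j (t + 1) = avoiding j t ∩ {x | x (t + 1) ≠ j} := by
  ext x
  simp only [avoiding, Set.mem_inter_iff, Set.mem_ofPred_eq]
  constructor
  · exact fun h => ⟨fun s hs => h s (by omega), h _ le_rfl⟩
  · rintro ⟨h1, h2⟩ s hs
    rcases Nat.lt_or_ge t s with h | h
    · obtain rfl : s = t + 1 := by omega
      exact h2
    · exact h1 s h

section Measurability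

variable {V : Type*} [MeasurableSpace V] [DiscreteMeasurableSpace V]

theorem measurableSet_avoiding (j : V) (t : ℕ) : MeasurableSet (avoiding j t) := by
  simp only [avoiding, Set.ofPred_forall]
  exact MeasurableSet.iInter fun s => MeasurableSet.iInter fun _ =>
    (measurableSet_singleton j).compl.preimage (measurable_pi_apply s)

theorem measurable_hittingTime (j : V) :
    Measurable fun x : ℕ → V => (hittingTime x j : ℝ≥0∞) := by
  simp only [hittingTime_eq_tsum]
  exact Measurable.tsum fun t => measurable_one.indicator (measurableSet_avoiding j t)

theorem lintegral_hittingTime (μ : Measure (ℕ → V)) (j : V) :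
    ∫⁻ x, (hittingTime x j : ℝ≥0∞) ∂μ = ∑' t, μ (avoiding j t) := by
  simp only [hittingTime_eq_tsum]
  rw [lintegral_tsum fun t =>
    (measurable_one.indicator (measurableSet_avoiding j t)).aemeasurable]
  exact tsum_congr fun t => lintegral_indicator_one (measurableSet_avoiding j t)

end Measurability

/-- If an integral over the set of trajectories avoiding `j` drops by the probability of that set
in each step, the expected hitting time is the initial value of the integral. -/
theorem tsum_eq_ofReal_of_telescoping {a W : ℕ → ℝ} {w C : ℝ} (ha : ∀ t, 0 ≤ a t)
    (h0 : W 0 = w) (hW : ∀ t, W (t + 1) = W t - a t) (ha1 : ∀ t, a t ≤ 1)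
    (hC : ∀ t, |W t| ≤ C * a t) :
    ∑' t, ENNReal.ofReal (a t) = ENNReal.ofReal w := by
  have hsum : ∀ n, ∑ t ∈ Finset.range n, a t = w - W n := by
    intro n
    induction n with
    | zero => simp [h0]
    | succ n ih => rw [Finset.sum_range_succ, ih, hW]; ring
  -- The bounds `|W n| ≤ C * a n` and `a n ≤ 1` keep the partial sums `w - W n` bounded. Summability
  -- then gives `a → 0`, and the same bound forces `W → 0`.
  have hsummable : Summable a := by
    refine summable_of_sum_range_le (c := w + |C|) ha fun n => ?_
    have h1 : C * a n ≤ |C| * 1 :=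
      mul_le_mul (le_abs_self C) (ha1 n) (ha n) (abs_nonneg C)
    have h2 := neg_abs_le (W n)
    linarith [hsum n, hC n]
  have hW0 : Filter.Tendsto W Filter.atTop (nhds 0) :=
    squeeze_zero_norm hC (by simpa using hsummable.tendsto_atTop_zero.const_mul C)
  have hlim : Filter.Tendsto (fun n => ∑ t ∈ Finset.range n, a t) Filter.atTop (nhds w) := by
    simp only [hsum]
    simpa using hW0.const_sub w
  rw [← ENNReal.ofReal_tsum_of_nonneg ha hsummable,
    tendsto_nhds_unique hsummable.hasSum.tendsto_sum_nat hlim]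

/-! ### The random walk and its expected hitting times -/

namespace WeightedGraph

variable {V : Type*} [Fintype V] [MeasurableSpace V] [DiscreteMeasurableSpace V]

theorem integral_stepKernel (G : WeightedGraph V) (i : V) (g : V → ℝ) :
    ∫ y, g y ∂(G.stepKernel i) = ∑ y, G.transitionMatrix y i * g y := by
  have h : G.stepKernel i = ∑ j, ENNReal.ofReal (G.transitionMatrix j i) • Measure.dirac j := rfl
  rw [h, integral_finsetSum_measure]
  · refine Finset.sum_congr rfl fun y _ => ?_
    rw [integral_smul_measure, integral_dirac, ENNReal.toReal_ofReal, smul_eq_mul]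
    refine div_nonneg (G.weight_nonneg i y) (Finset.sum_nonneg fun z _ => G.weight_nonneg i z)
  · intro y _
    exact (integrable_dirac (by simp)).smul_measure ENNReal.ofReal_ne_top

variable [Nontrivial V]

instance (G : WeightedGraph V) (i : V) : IsProbabilityMeasure (G.walkLaw i) := by
  unfold walkLaw; infer_instance

theorem walkLaw_map_zero (G : WeightedGraph V) (i : V) :
    (G.walkLaw i).map (fun x => x 0) = Measure.dirac i := by
  have hm : Measurable fun y : Finset.Iic 0 → V => y ⟨0, Finset.mem_Iic.2 le_rfl⟩ :=
    measurable_pi_apply _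
  have h : (G.walkLaw i).map (Preorder.frestrictLe 0)
      = (Measure.dirac i).map
        (MeasurableEquiv.piUnique fun _ : Finset.Iic 0 => V).symm := by
    rw [walkLaw, Kernel.trajMeasure, Measure.map_comp _ _ (by fun_prop),
      Kernel.traj_map_frestrictLe, Kernel.partialTraj_self, Measure.id_comp]
  have h' := congrArg (Measure.map fun y => y ⟨0, Finset.mem_Iic.2 le_rfl⟩) h
  rw [Measure.map_map hm (by fun_prop), Measure.map_map hm (by fun_prop),
    Measure.map_dirac' (by fun_prop)] at h'
  exact h'

/-- The Markov property: avoiding `j` up to time `t` depends only on the trajectory up to `t`, given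
which the next node has the law of one step from `x t`. -/
theorem setIntegral_avoiding_comp_succ (G : WeightedGraph V) (i j : V) (t : ℕ) (g : V → ℝ) :
    ∫ x in avoiding j t, g (x (t + 1)) ∂(G.walkLaw i)
      = ∫ x in avoiding j t, ∑ y, G.transitionMatrix y (x t) * g y ∂(G.walkLaw i) := by
  have h := Kernel.map_frestrictLe_trajMeasure_compProd_eq_map_trajMeasure (X := fun _ => V)
    (μ₀ := Measure.dirac i) (a := t) (κ := fun n =>
    G.stepKernel.comap (fun h : (Finset.Iic n → V) => h ⟨n, Finset.mem_Iic.2 le_rfl⟩)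
      (measurable_pi_apply _))
  change (G.walkLaw i).map _ ⊗ₘ _ = (G.walkLaw i).map _ at h
  set μ := G.walkLaw i
  set B : Set (Finset.Iic t → V) := {y | ∀ s, y s ≠ j}
  have hB : MeasurableSet B := by
    simp only [B, Set.ofPred_forall]
    exact MeasurableSet.iInter fun s =>
      (measurableSet_singleton j).compl.preimage (measurable_pi_apply s)
  have hpre : Preorder.frestrictLe (π := fun _ => V) t ⁻¹' B = avoiding j t := by
    ext x
    simp [B, avoiding]
  have hg : Measurable g := .of_discrete
  have hbdd : ∀ v, ‖g v‖ ≤ ∑ v, ‖g v‖ := fun v =>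
    Finset.single_le_sum (fun v _ => norm_nonneg (g v)) (Finset.mem_univ v)
  have hmap : ∫ x in avoiding j t, g (x (t + 1)) ∂μ
      = ∫ z in B ×ˢ Set.univ, g z.2 ∂(μ.map fun x => (Preorder.frestrictLe t x, x (t + 1))) := by
    rw [setIntegral_map (f := fun z => g z.2) (hB.prod .univ)
      (hg.comp measurable_snd).aestronglyMeasurable
      (by fun_prop)]
    congr 2
    rw [← hpre]
    ext x
    simp
  have hprob : IsProbabilityMeasure (μ.map (Preorder.frestrictLe (π := fun _ => V) t)) :=
    Measure.isProbabilityMeasure_map (by fun_prop)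
  have hκ : ∀ y : Finset.Iic t → V, ∫ b in Set.univ, g b ∂(G.stepKernel.comap
      (fun h : (Finset.Iic t → V) => h ⟨t, Finset.mem_Iic.2 le_rfl⟩) (measurable_pi_apply _)) y
      = ∑ v, G.transitionMatrix v (y ⟨t, Finset.mem_Iic.2 le_rfl⟩) * g v := fun y => by
    rw [Measure.restrict_univ]
    exact G.integral_stepKernel _ g
  rw [hmap, ← h, Measure.setIntegral_compProd hB .univ]
  · simp only [hκ]
    rw [← hpre]
    have hT : Measurable fun u => ∑ v, G.transitionMatrix v u * g v := .of_discrete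
    exact setIntegral_map (f := fun y : Finset.Iic t → V =>
      ∑ v, G.transitionMatrix v (y ⟨t, Finset.mem_Iic.2 le_rfl⟩) * g v) hB
      (hT.comp (measurable_pi_apply _)).aestronglyMeasurable (by fun_prop)
  · exact (Integrable.of_bound (hg.comp measurable_snd).aestronglyMeasurable (∑ v, ‖g v‖)
      (.of_forall fun z => hbdd _)).integrableOn

theorem integrable_comp_apply (G : WeightedGraph V) (i : V) (t : ℕ) (g : V → ℝ) :
    Integrable (fun x => g (x t)) (G.walkLaw i) := by
  have hg : Measurable g := .of_discrete
  exact Integrable.of_bound (hg.comp (measurable_pi_apply t)).aestronglyMeasurable (∑ v, ‖g v‖)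
    (.of_forall fun x =>
      Finset.single_le_sum (fun v _ => norm_nonneg (g v)) (Finset.mem_univ (x t)))

variable [DecidableEq V]

theorem lintegral_hittingTime_walkLaw (G : WeightedGraph V) (i j : V) :
    ∫⁻ x, (hittingTime x j : ℝ≥0∞) ∂(G.walkLaw i) = ENNReal.ofReal (G.meanHittingTime j i) := by
  set μ := G.walkLaw i
  set g := G.meanHittingTime j
  have hgj : g j = 0 := G.meanHittingTime_self j
  have hg : Measurable g := .of_discrete
  have hfin : ∀ t, μ (avoiding j t) = ENNReal.ofReal (μ.real (avoiding j t)) := fun t =>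
    (ofReal_measureReal (measure_ne_top μ _)).symm
  rw [lintegral_hittingTime]
  simp only [hfin]
  -- The constant `C` is a uniform bound for `|g|` on the finite set of nodes.
  refine tsum_eq_ofReal_of_telescoping (W := fun t => ∫ x in avoiding j t, g (x t) ∂μ)
    (C := ∑ v, ‖g v‖) (fun t => measureReal_nonneg) ?_ (fun t => ?_)
    (fun t => measureReal_le_one) (fun t => ?_)
  · rw [setIntegral_eq_integral_of_forall_compl_eq_zero]
    · rw [← integral_map (μ := μ) (φ := fun x : ℕ → V => x 0) (f := g)
        (measurable_pi_apply 0).aemeasurable hg.aestronglyMeasurable, G.walkLaw_map_zero,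
        integral_dirac]
    · intro x hx
      have h0 : x 0 = j := by simpa [avoiding] using hx
      rw [h0, hgj]
  -- Trajectories that first reach `j` at time `t + 1` contribute nothing because `g j = 0`, so the
  -- domain of integration may be enlarged.
  · have hsub : ∫ x in avoiding j (t + 1), g (x (t + 1)) ∂μ
        = ∫ x in avoiding j t, g (x (t + 1)) ∂μ := by
      refine (setIntegral_eq_of_subset_of_forall_sdiff_eq_zero (measurableSet_avoiding j t)
        (avoiding_succ j t ▸ Set.inter_subset_left) fun x hx => ?_).symm
      rw [avoiding_succ] at hx
      have h1 : x (t + 1) = j := by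
        by_contra h
        exact hx.2 ⟨hx.1, h⟩
      rw [h1, hgj]
    have hstep : ∫ x in avoiding j t, ∑ y, G.transitionMatrix y (x t) * g y ∂μ
        = ∫ x in avoiding j t, (g (x t) - 1) ∂μ :=
      setIntegral_congr_fun (measurableSet_avoiding j t) fun x hx =>
        G.sum_transitionMatrix_mul_meanHittingTime (hx t le_rfl)
    change ∫ x in avoiding j (t + 1), g (x (t + 1)) ∂μ = _
    rw [hsub, G.setIntegral_avoiding_comp_succ, hstep,
      integral_sub (G.integrable_comp_apply i t g).integrableOn (integrable_const 1)]
    simp [μ]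
  · refine norm_setIntegral_le_of_norm_le_const (f := fun x => g (x t)) (s := avoiding j t)
      (measure_lt_top μ _) fun x _ => ?_
    exact Finset.single_le_sum (fun v _ => norm_nonneg (g v)) (Finset.mem_univ (x t))

theorem kemenyTime_eq (G : WeightedGraph V) (i : V) :
    G.kemenyTime i
      = ENNReal.ofReal (2 * G.totalWeight * G.resistanceVariance G.stationary) := by
  have hmeas : Measurable fun z : (ℕ → V) × V => (hittingTime z.1 z.2 : ℝ≥0∞) :=
    measurable_from_prod_countable_left measurable_hittingTime
  have hfin : IsFiniteMeasure G.stationaryLaw := by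
    refine ⟨?_⟩
    simp [stationaryLaw]
  -- Tonelli: integrating over the trajectory first leaves the `π`-average of the mean hitting
  -- times.
  rw [kemenyTime, lintegral_prod_symm _ hmeas.aemeasurable]
  simp only [lintegral_hittingTime_walkLaw, stationaryLaw]
  rw [lintegral_finsetSum_measure, ← G.sum_stationary_mul_meanHittingTime i,
    ENNReal.ofReal_sum_of_nonneg fun j _ =>
      mul_nonneg (G.stationary_nonneg j) (G.meanHittingTime_nonneg j i)]
  refine Finset.sum_congr rfl fun j _ => ?_
  rw [lintegral_smul_measure, lintegral_dirac, smul_eq_mul,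
    ENNReal.ofReal_mul (G.stationary_nonneg j)]

end WeightedGraph

theorem mainTheorem10 {V : Type*} [Fintype V] [DecidableEq V] [Nontrivial V]
    [MeasurableSpace V] [DiscreteMeasurableSpace V] (G : WeightedGraph V) :
    (∀ p : V → ℝ, G.IsStationary p ↔ p = G.stationary) ∧
      ∀ i : V, G.kemenyTime i ≠ ⊤ ∧
        (G.kemenyTime i).toReal = 2 * G.totalWeight * G.resistanceVariance G.stationary := by
  refine ⟨G.isStationary_iff, fun i => ?_⟩
  rw [G.kemenyTime_eq]
  -- `ENNReal.ofReal` truncates negative values to zero, so the right side must be shown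
  -- nonnegative; it is an average of nonnegative mean hitting times.
  refine ⟨ENNReal.ofReal_ne_top, ENNReal.toReal_ofReal ?_⟩
  rw [← G.sum_stationary_mul_meanHittingTime i]
  exact Finset.sum_nonneg fun j _ =>
    mul_nonneg (G.stationary_nonneg j) (G.meanHittingTime_nonneg j i)
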